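/- Write $\mathbb D$ for the open unit disc and, for an open set $X\subset\mathbb C$, write $\mathcal O(\mathbb D,X)$ for the set of holomorphic maps $\mathbb D\to X$. Let $X\subset\mathbb C$ be open and suppose that there is a holomorphic $F:\mathbb D\to\mathbb C$ with $F(\mathbb D)=X$ which is proper as a map $\mathbb D\to X$. Let $p_1,\dots,p_N\in X$ and $m_1,\dots,m_N>0$, and put $\alpha=\sum_{j=1}^N m_j\chi_{\{p_j\}}$. For $f\in\mathcal O(\mathbb D,X)$ let $$H^L_\alpha(f)=\sum_{a\in\mathbb D}\alpha(f(a))\,m_a(f)\log|a|\in[-\infty,0],$$ where $m_a(f)$ is the order of vanishing of $f-f(a)$ at $a$ ($\infty$ if $f$ is constant) and $\log 0=-\infty$, $0\cdot(\pm\infty)=0$; and for $x\in X$ let $$EH^L_\alpha(x)=\inf\{H^L_\alpha(f): f\in\mathcal O(\mathbb D,X),\ f(0)=x\}.$$ Then for every $x\in X$ the infimum is a minimum: there is a holomorphic automorphism $\psi$ of $\mathbb D$ with $F(\psi(0))=x$, and for every such $\psi$ the disc $f=F\circ\psi$ belongs to $\mathcal O(\mathbb D,X)$, has $f(0)=x$,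 and satisfies $$EH^L_\alpha(x)=H^L_\alpha(f)=\sum_{a\in\mathbb D}\alpha(f(a))\,m_a(f)\log|a|.$$ -/

import Mathlib

open Set Metric

noncomputable section

/-- The set `O(𝔻, X)` of analytic discs in `X`: holomorphic maps from the open unit disc into `X`
(represented by functions on `ℂ`, of which only the restriction to the disc matters). -/
def analyticDiscs (X : Set ℂ) : Set (ℂ → ℂ) :=
  {f | DifferentiableOn ℂ f (ball 0 1) ∧ MapsTo f (ball 0 1) X}

/-- `ψ` is a holomorphic automorphism of the open unit disc: a holomorphic self-map of the disc
with a holomorphic inverse. -/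
def IsDiscAutomorphism (ψ : ℂ → ℂ) : Prop :=
  ψ ∈ analyticDiscs (ball 0 1) ∧
    ∃ φ ∈ analyticDiscs (ball 0 1), InvOn φ ψ (ball 0 1) (ball 0 1)

/-- The weight function `α = ∑ j, m j • χ_{p j}`. -/
def poleWeight {N : ℕ} (p : Fin N → ℂ) (m : Fin N → ℝ) (z : ℂ) : ℝ :=
  ∑ j, m j * ({p j} : Set ℂ).indicator 1 z

/-- The multiplicity of `f` at `a`: the order of vanishing of `f - f a` at `a`
(it is `⊤` exactly when `f` is constant near `a`). -/
def multiplicityAt (f : ℂ → ℂ) (a : ℂ) : ℕ∞ :=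
  analyticOrderAt (fun z => f z - f a) a

/-- The term `α (f a) * m_a * log |a|` of the Lelong functional, in `[-∞, ∞]`, with
`log 0 = -∞` and `0 * (±∞) = 0`. -/
def lelongTerm (α : ℂ → ℝ) (f : ℂ → ℂ) (a : ℂ) : EReal :=
  (α (f a) : EReal) * ((multiplicityAt f a : ENNReal) : EReal) * ENNReal.log ‖a‖ₑ

/-- The Lelong functional `H_α(f) = ∑_{a ∈ 𝔻} α (f a) * m_a * log |a|`, with values in
`[-∞, ∞]`. -/
def lelongFunctional (α : ℂ → ℝ) (f : ℂ → ℂ) : EReal :=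
  ∑' a : ball (0 : ℂ) 1, lelongTerm α f a

/-- The envelope of the Lelong functional on `X`: the infimum of `H_α(f)` over the analytic discs
`f` in `X` centred at `x`. -/
def lelongEnvelope (X : Set ℂ) (α : ℂ → ℝ) (x : ℂ) : EReal :=
  sInf (lelongFunctional α '' {f | f ∈ analyticDiscs X ∧ f 0 = x})

/-- For a nonnegative weight all terms are nonpositive. -/
theorem lelongTerm_nonpos {α : ℂ → ℝ} (hα : ∀ z, 0 ≤ α z) (f : ℂ → ℂ) (a : ball (0 : ℂ) 1) :
    lelongTerm α f a ≤ 0 := by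
  have h1 : ENNReal.log ‖(a : ℂ)‖ₑ ≤ 0 := by
    rw [ENNReal.log_le_zero_iff, ← ofReal_norm]
    exact ENNReal.ofReal_le_one.2 (mem_ball_zero_iff.1 a.2).le
  have h2 : (0 : EReal) ≤ (α (f a) : EReal) * ((multiplicityAt f a : ENNReal) : EReal) :=
    mul_nonneg (EReal.coe_nonneg.2 (hα _)) (EReal.coe_ennreal_nonneg _)
  exact EReal.mul_nonpos_iff.2 (Or.inl ⟨h2, h1⟩)

/-- For a nonnegative weight the sum defining the Lelong functional always converges (possibly to
`-∞`): its value is the infimum of the finite partial sums. -/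
theorem hasSum_lelongFunctional {α : ℂ → ℝ} (hα : ∀ z, 0 ≤ α z) (f : ℂ → ℂ) :
    HasSum (fun a : ball (0 : ℂ) 1 => lelongTerm α f a) (lelongFunctional α f) ∧
      lelongFunctional α f =
        ⨅ s : Finset (ball (0 : ℂ) 1), ∑ a ∈ s, lelongTerm α f a := by
  have h : HasSum (fun a : ball (0 : ℂ) 1 => lelongTerm α f a)
      (⨅ s : Finset (ball (0 : ℂ) 1), ∑ a ∈ s, lelongTerm α f a) := by
    refine tendsto_atTop_iInf ?_
    intro s t hst
    exact Finset.sum_anti_set_of_nonpos'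
      (fun a => lelongTerm_nonpos hα f a) hst
  exact ⟨h.summable.hasSum, h.tsum_eq⟩

end

/-! Put `G = F ∘ ψ`, which is again proper onto `X`, and let `f` be a competitor with `f 0 = G 0 =
x`. If `x` is a pole, both functionals are `-∞`. Otherwise, grouping terms by poles, it suffices to
compare for each pole `p` the Blaschke product `B_T` of all `p`-points of `G` (finitely many, by
properness) with the product `B_S` of any finitely many `p`-points of `f`, and to show `|B_T(0)| ≤
|B_S(0)|` (`prod_norm_pow_le_of_fibreProduct`).

There need be no lift of `f` through `G`, so the comparison is made on the fibre product `{(ζ, z) :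
G z = f ζ}`, which contains `(0, 0)`. There `B_T(z) / B_S(ζ)` extends to a product `E(z) e(ζ)` of
holomorphic functions, because `G z - p = f ζ - p`. Properness makes the part over `|ζ| ≤ r`
compact, so `|E e|` at `(0, 0)` is at most its value at some point over `|ζ| = r`
(`exists_norm_eq_le_of_fibreProduct`). There `|B_T| ≤ 1`, while `|B_S|` is close to `1` for suitable
`r` near `1`.

The fibre product may be singular; the maximum principle is applied along Puiseux curves `s ↦ (ζ + s
^ k, σ s)` from `exists_analytic_lift`. -/

/-! ### Local lifting through a nonconstant germ -/

open Filter Topology in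
/-- A nonvanishing analytic germ has analytic `k`-th roots. -/
theorem AnalyticAt.exists_root {g : ℂ → ℂ} {a : ℂ} (hg : AnalyticAt ℂ g a) (h0 : g a ≠ 0)
    {k : ℕ} (hk : k ≠ 0) :
    ∃ h : ℂ → ℂ, AnalyticAt ℂ h a ∧ h a ≠ 0 ∧ ∀ᶠ z in 𝓝 a, h z ^ k = g z := by
  obtain ⟨c, hc⟩ := IsAlgClosed.exists_pow_nat_eq (g a) (Nat.pos_of_ne_zero hk)
  have hc0 : c ≠ 0 := by
    rintro rfl
    exact h0 (by rw [← hc, zero_pow hk])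
  have hkC : (k : ℂ) ≠ 0 := Nat.cast_ne_zero.2 hk
  -- Dividing by `g a` moves the value at `a` to `1`, off the branch cut of the logarithm.
  refine ⟨fun z => c * Complex.exp (Complex.log (g z / g a) / k), ?_, ?_, ?_⟩
  · have h1 : AnalyticAt ℂ (fun z => g z / g a) a := hg.div analyticAt_const h0
    have h2 : AnalyticAt ℂ (fun z => Complex.log (g z / g a)) a :=
      h1.clog (by simp [h0])
    exact analyticAt_const.mul ((h2.div analyticAt_const hkC).cexp)
  · exact mul_ne_zero hc0 (Complex.exp_ne_zero _)
  · filter_upwards [hg.continuousAt.eventually_ne h0] with z hz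
    rw [mul_pow, hc, ← Complex.exp_nat_mul, mul_div_cancel₀ _ hkC,
      Complex.exp_log (div_ne_zero hz h0), mul_div_cancel₀ _ h0]

open Filter Topology in
/-- After a substitution `ζ = ζ₀ + s ^ k`, an analytic germ can be lifted through a nonconstant
analytic germ. -/
theorem exists_analytic_lift {F f : ℂ → ℂ} {z₀ ζ₀ : ℂ} (hF : AnalyticAt ℂ F z₀)
    (hFn : analyticOrderAt (fun z => F z - F z₀) z₀ ≠ ⊤) (hf : AnalyticAt ℂ f ζ₀)
    (h : F z₀ = f ζ₀) :
    ∃ k : ℕ, k ≠ 0 ∧ ∃ σ : ℂ → ℂ, AnalyticAt ℂ σ 0 ∧ σ 0 = z₀ ∧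
      ∀ᶠ s in 𝓝 0, F (σ s) = f (ζ₀ + s ^ k) := by
  have hF' : AnalyticAt ℂ (fun z => F z - F z₀) z₀ := hF.sub analyticAt_const
  obtain ⟨k, hk⟩ := ENat.ne_top_iff_exists.1 hFn
  obtain ⟨g, hg, hg0, hFg⟩ := hF'.analyticOrderAt_eq_natCast.1 hk.symm
  have hk0 : k ≠ 0 := by
    rintro rfl
    have := hFg.self_of_nhds
    simp only [sub_self, pow_zero, one_smul] at this
    exact hg0 this.symm
  obtain ⟨h₁, hh₁, hh₁0, hroot⟩ := hg.exists_root hg0 hk0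
  have hζ : Tendsto (fun s : ℂ => ζ₀ + s ^ k) (𝓝 0) (𝓝 ζ₀) := by
    have : ContinuousAt (fun s : ℂ => ζ₀ + s ^ k) 0 := by fun_prop
    simpa [ContinuousAt, hk0] using this
  refine ⟨k, hk0, ?_⟩
  by_cases hft : analyticOrderAt (fun z => f z - f ζ₀) ζ₀ = ⊤
  · refine ⟨fun _ => z₀, analyticAt_const, rfl, ?_⟩
    filter_upwards [hζ.eventually (analyticOrderAt_eq_top.1 hft)] with s hs
    rw [h, sub_eq_zero.1 hs]
  obtain ⟨j, hj⟩ := ENat.ne_top_iff_exists.1 hft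
  have hf' : AnalyticAt ℂ (fun z => f z - f ζ₀) ζ₀ := hf.sub analyticAt_const
  obtain ⟨g₂, hg₂, hg₂0, hfg⟩ := hf'.analyticOrderAt_eq_natCast.1 hj.symm
  have hj0 : j ≠ 0 := by
    rintro rfl
    have := hfg.self_of_nhds
    simp only [sub_self, pow_zero, one_smul] at this
    exact hg₂0 this.symm
  obtain ⟨h₂, hh₂, hh₂0, hroot₂⟩ := hg₂.exists_root hg₂0 hk0
  -- `ρ` is a local coordinate with `F - F z₀ = ρ ^ k`. After the substitution, `f - f ζ₀` becomes
  -- the `k`-th power of `θ` below, so `σ` is found by solving `ρ (σ s) = θ s`.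
  set ρ : ℂ → ℂ := fun z => (z - z₀) * h₁ z with hρdef
  have hρ : AnalyticAt ℂ ρ z₀ := (analyticAt_id.sub analyticAt_const).mul hh₁
  have hρ0 : ρ z₀ = 0 := by simp [hρdef]
  have hρ' : deriv ρ z₀ ≠ 0 := by
    have : HasDerivAt ρ (1 * h₁ z₀ + (z₀ - z₀) * deriv h₁ z₀) z₀ :=
      ((hasDerivAt_id z₀).sub_const z₀).mul hh₁.differentiableAt.hasDerivAt
    rw [this.deriv]
    simpa using hh₁0
  set τ := hρ.hasStrictDerivAt.localInverse _ _ _ hρ'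
  have hτ : AnalyticAt ℂ τ 0 := hρ0 ▸ hρ.analyticAt_localInverse hρ'
  have hτ0 : τ 0 = z₀ := by
    have : τ (ρ z₀) = z₀ := HasStrictFDerivAt.localInverse_apply_image ..
    rwa [hρ0] at this
  have hρτ : ∀ᶠ w in 𝓝 0, ρ (τ w) = w := by
    have : ∀ᶠ w in 𝓝 (ρ z₀), ρ (τ w) = w := HasStrictDerivAt.eventually_right_inverse ..
    rwa [hρ0] at this
  set θ : ℂ → ℂ := fun s => s ^ j * h₂ (ζ₀ + s ^ k) with hθdef
  have hζa : AnalyticAt ℂ (fun s : ℂ => ζ₀ + s ^ k) 0 :=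
    analyticAt_const.add (analyticAt_id.pow k)
  have hθ : AnalyticAt ℂ θ 0 :=
    (analyticAt_id.pow j).mul (AnalyticAt.fun_comp (by simpa [hk0] using hh₂) hζa)
  have hθ0 : θ 0 = 0 := by simp [hθdef, hj0]
  have hθt : Tendsto θ (𝓝 0) (𝓝 0) := by simpa [ContinuousAt, hθ0] using hθ.continuousAt
  have hσ : AnalyticAt ℂ (fun s => τ (θ s)) 0 := AnalyticAt.fun_comp (by rwa [hθ0]) hθ
  have hσ0 : τ (θ 0) = z₀ := by rw [hθ0, hτ0]
  have hσt : Tendsto (fun s => τ (θ s)) (𝓝 0) (𝓝 z₀) := by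
    simpa [ContinuousAt, hθ0, hτ0] using hσ.continuousAt
  refine ⟨_, hσ, hσ0, ?_⟩
  filter_upwards [hσt.eventually hFg, hσt.eventually hroot, hθt.eventually hρτ,
    hζ.eventually hfg, hζ.eventually hroot₂] with s h1 h2 h3 h4 h5
  have h6 : F (τ (θ s)) - F z₀ = θ s ^ k := by
    rw [h1, ← h2, smul_eq_mul, ← mul_pow]
    exact congrArg (· ^ k) h3
  have h7 : f (ζ₀ + s ^ k) - f ζ₀ = θ s ^ k := by
    rw [h4, ← h5, smul_eq_mul, hθdef]
    ring
  rw [← h, ← h6] at h7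
  exact (sub_left_inj.1 h7).symm

/-! ### Maximum principle on the fibre product -/

open Filter Topology in
/-- The maximum principle on the fibre product `{(ζ, z) : G z = f ζ}`, which is compact over
`‖ζ‖ ≤ r`. -/
theorem exists_norm_eq_le_of_fibreProduct {G f E e : ℂ → ℂ} {r : ℝ} (hr : r < 1)
    (hG : DifferentiableOn ℂ G (ball 0 1)) (hf : DifferentiableOn ℂ f (ball 0 1))
    (hE : DifferentiableOn ℂ E (ball 0 1)) (he : DifferentiableOn ℂ e (ball 0 1))
    (hGn : ∀ z ∈ ball (0 : ℂ) 1, analyticOrderAt (fun w => G w - G z) z ≠ ⊤)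
    (hY : IsCompact {y : ℂ × ℂ | y.1 ∈ closedBall 0 r ∧ y.2 ∈ ball (0 : ℂ) 1 ∧ G y.2 = f y.1})
    {ζ₀ z₀ : ℂ} (hζ₀ : ζ₀ ∈ closedBall 0 r) (hz₀ : z₀ ∈ ball (0 : ℂ) 1) (h₀ : G z₀ = f ζ₀) :
    ∃ ζ z : ℂ, ‖ζ‖ = r ∧ z ∈ ball (0 : ℂ) 1 ∧ G z = f ζ ∧ ‖E z₀ * e ζ₀‖ ≤ ‖E z * e ζ‖ := by
  set Y := {y : ℂ × ℂ | y.1 ∈ closedBall 0 r ∧ y.2 ∈ ball (0 : ℂ) 1 ∧ G y.2 = f y.1} with hYdef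
  have hrb : closedBall (0 : ℂ) r ⊆ ball 0 1 := closedBall_subset_ball hr
  set Φ : ℂ × ℂ → ℝ := fun y => ‖E y.2 * e y.1‖ with hΦdef
  have hΦ : ContinuousOn Φ Y :=
    ((hE.continuousOn.comp continuousOn_snd fun y hy => hy.2.1).mul
      (he.continuousOn.comp continuousOn_fst fun y hy => hrb hy.1)).norm
  obtain ⟨y₁, hy₁, hmax⟩ := hY.exists_isMaxOn ⟨(ζ₀, z₀), hζ₀, hz₀, h₀⟩ hΦ
  have hM : IsCompact (Y ∩ Φ ⁻¹' {Φ y₁}) := by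
    refine hY.of_isClosed_subset ?_ inter_subset_left
    exact hΦ.preimage_isClosed_of_isClosed hY.isClosed isClosed_singleton
  -- Among the maximizers of `Φ`, take one with `‖ζ‖` largest. If it were interior, `Φ` would be
  -- constant along a curve through it, and `‖ζ + s ^ k‖` would have a local maximum at `s = 0`,
  -- which is impossible.
  obtain ⟨⟨ζ, z⟩, ⟨⟨hζr, hz, hGf⟩, hΦeq⟩, hmax₂⟩ :=
    hM.exists_isMaxOn ⟨y₁, hy₁, rfl⟩ (f := fun y => ‖y.1‖) (by fun_prop)
  have hΦeq : Φ (ζ, z) = Φ y₁ := hΦeq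
  have hζr' : ‖ζ‖ ≤ r := by simpa using hζr
  refine ⟨ζ, z, ?_, hz, hGf, ?_⟩
  swap
  · exact (hmax (show (ζ₀, z₀) ∈ Y from ⟨hζ₀, hz₀, h₀⟩)).trans_eq hΦeq.symm
  by_contra hne
  have hlt : ‖ζ‖ < r := lt_of_le_of_ne hζr' hne
  have hζ1 : ζ ∈ ball (0 : ℂ) 1 := hrb hζr
  have han : ∀ {g : ℂ → ℂ}, DifferentiableOn ℂ g (ball 0 1) → ∀ w ∈ ball (0 : ℂ) 1,
      AnalyticAt ℂ g w := fun hg w hw => hg.analyticAt (isOpen_ball.mem_nhds hw)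
  obtain ⟨k, hk, σ, hσ, hσ0, hlift⟩ :=
    exists_analytic_lift (han hG z hz) (hGn z hz) (han hf ζ hζ1) hGf
  have hζa : AnalyticAt ℂ (fun s : ℂ => ζ + s ^ k) 0 :=
    analyticAt_const.add (analyticAt_id.pow k)
  have hζt : Tendsto (fun s : ℂ => ζ + s ^ k) (𝓝 0) (𝓝 ζ) := by
    simpa [ContinuousAt, hk] using hζa.continuousAt
  have hσt : Tendsto σ (𝓝 0) (𝓝 z) := by simpa [ContinuousAt, hσ0] using hσ.continuousAt
  have hmemY : ∀ᶠ s in 𝓝 (0 : ℂ), (ζ + s ^ k, σ s) ∈ Y := by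
    filter_upwards [hlift, hσt.eventually (isOpen_ball.mem_nhds hz),
      hζt.eventually (isOpen_ball.mem_nhds (show ζ ∈ ball (0 : ℂ) r by simpa using hlt))]
      with s h1 h2 h3
    exact ⟨ball_subset_closedBall h3, h2, h1⟩
  have hga : AnalyticAt ℂ (fun s => E (σ s) * e (ζ + s ^ k)) 0 :=
    (AnalyticAt.fun_comp (by rw [hσ0]; exact han hE z hz) hσ).mul
      (AnalyticAt.fun_comp (by simpa [hk] using han he ζ hζ1) hζa)
  have hconst := Complex.norm_eventually_eq_of_isLocalMax
    (f := fun s => E (σ s) * e (ζ + s ^ k)) (c := 0)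
    (hga.eventually_analyticAt.mono fun s hs => hs.differentiableAt) <| by
      filter_upwards [hmemY] with s hs
      have h1 : Φ (ζ + s ^ k, σ s) ≤ Φ (ζ, z) := (hmax hs).trans_eq hΦeq.symm
      simpa [hΦdef, hσ0, hk] using h1
  have hloc : IsLocalMax (norm ∘ fun s : ℂ => ζ + s ^ k) 0 := by
    filter_upwards [hmemY, hconst] with s hs h1
    have h2 : Φ (ζ + s ^ k, σ s) = Φ y₁ := by
      rw [← hΦeq]
      simpa [hΦdef, hσ0, hk] using h1
    simpa [hk] using hmax₂ (show (ζ + s ^ k, σ s) ∈ Y ∩ Φ ⁻¹' {Φ y₁} from ⟨hs, h2⟩)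
  have hzero := Complex.eventually_eq_of_isLocalMax_norm
    (hζa.eventually_analyticAt.mono fun s hs => hs.differentiableAt) hloc
  have hzero' : ∀ᶠ s in 𝓝[≠] (0 : ℂ), False := by
    filter_upwards [hzero.filter_mono nhdsWithin_le_nhds, self_mem_nhdsWithin] with s hs hs0
    simp only [ne_eq, hk, not_false_eq_true, zero_pow, add_zero, add_eq_left,
      pow_eq_zero_iff] at hs
    exact hs0 hs
  exact hzero'.exists.choose_spec

/-! ### Dividing out zeros -/

open Filter Topology in
/-- Division of a holomorphic function by a power of `z - a`. -/
theorem DifferentiableOn.exists_eq_pow_mul {U : Set ℂ} (hU : IsOpen U) {f : ℂ → ℂ}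
    (hf : DifferentiableOn ℂ f U) {a : ℂ} (ha : a ∈ U) {n : ℕ} (hn : n ≤ analyticOrderAt f a) :
    ∃ g : ℂ → ℂ, DifferentiableOn ℂ g U ∧ (∀ z, f z = (z - a) ^ n * g z) ∧
      n + analyticOrderAt g a = analyticOrderAt f a ∧
      ∀ b ∈ U, b ≠ a → analyticOrderAt g b = analyticOrderAt f b := by
  have hfa : AnalyticAt ℂ f a := hf.analyticAt (hU.mem_nhds ha)
  obtain ⟨g₀, hg₀, hfg₀⟩ := (natCast_le_analyticOrderAt hfa).1 hn
  classical
  set g : ℂ → ℂ := Function.update (fun z => f z / (z - a) ^ n) a (g₀ a) with hg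
  have hga : g =ᶠ[𝓝 a] g₀ := by
    filter_upwards [hfg₀] with z hz
    by_cases hza : z = a
    · simp [hg, hza]
    · rw [hg, Function.update_of_ne hza, hz, smul_eq_mul,
        mul_div_cancel_left₀ _ (pow_ne_zero _ (sub_ne_zero.2 hza))]
  have hgb : ∀ b, b ≠ a → g =ᶠ[𝓝 b] fun z => f z / (z - a) ^ n := fun b hb => by
    filter_upwards [isOpen_ne.mem_nhds hb] with z hz
    rw [hg, Function.update_of_ne hz]
  have hgU : DifferentiableOn ℂ g U := by
    intro b hb
    by_cases hba : b = a
    · subst hba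
      exact (hg₀.congr hga.symm).differentiableAt.differentiableWithinAt
    · have hfb := hf.differentiableAt (hU.mem_nhds hb)
      have h1 : DifferentiableAt ℂ (fun z => f z / (z - a) ^ n) b :=
        hfb.div (by fun_prop) (pow_ne_zero _ (sub_ne_zero.2 hba))
      exact (h1.congr_of_eventuallyEq (hgb b hba)).differentiableWithinAt
  have heq : ∀ z, f z = (z - a) ^ n * g z := by
    intro z
    by_cases hza : z = a
    · subst hza
      simpa [hg] using hfg₀.self_of_nhds
    · rw [hg, Function.update_of_ne hza,
        mul_div_cancel₀ _ (pow_ne_zero _ (sub_ne_zero.2 hza))]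
  have hfmul : f = (fun z => (z - a) ^ n) * g := funext heq
  have hpow : ∀ b, AnalyticAt ℂ (fun z : ℂ => (z - a) ^ n) b := fun b =>
    (analyticAt_id.sub analyticAt_const).pow n
  have hgan : ∀ b ∈ U, AnalyticAt ℂ g b := fun b hb => hgU.analyticAt (hU.mem_nhds hb)
  refine ⟨g, hgU, heq, ?_, fun b hb hba => ?_⟩
  · conv_rhs => rw [hfmul, analyticOrderAt_mul (hpow a) (hgan a ha)]
    rw [show (fun z : ℂ => (z - a) ^ n) = (· - a) ^ n from rfl, analyticOrderAt_centeredMonomial]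
  · conv_rhs => rw [hfmul, analyticOrderAt_mul (hpow b) (hgan b hb)]
    rw [((hpow b).analyticOrderAt_eq_zero).2 (pow_ne_zero _ (sub_ne_zero.2 hba)), zero_add]

/-- Division of a holomorphic function by finitely many of its zeros. -/
theorem DifferentiableOn.exists_eq_prod_mul {U : Set ℂ} (hU : IsOpen U) {f : ℂ → ℂ}
    (hf : DifferentiableOn ℂ f U) (n : ℂ → ℕ) (S : Finset ℂ) (hS : ∀ a ∈ S, a ∈ U)
    (hn : ∀ a ∈ S, n a ≤ analyticOrderAt f a) :
    ∃ g : ℂ → ℂ, DifferentiableOn ℂ g U ∧ (∀ z ∈ U, f z = (∏ a ∈ S, (z - a) ^ n a) * g z) ∧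
      (∀ a ∈ S, n a + analyticOrderAt g a = analyticOrderAt f a) ∧
      ∀ b ∈ U, b ∉ S → analyticOrderAt g b = analyticOrderAt f b := by
  classical
  induction S using Finset.induction_on with
  | empty => exact ⟨f, hf, by simp, by simp, by simp⟩
  | insert a S ha ih =>
    simp only [Finset.mem_insert, forall_eq_or_imp] at hS hn
    obtain ⟨g, hg, hfg, h1, h2⟩ := ih hS.2 hn.2
    obtain ⟨g', hg', hgg, h3, h4⟩ :=
      hg.exists_eq_pow_mul hU hS.1 (n := n a) (by rw [h2 a hS.1 ha]; exact hn.1)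
    refine ⟨g', hg', fun z hz => ?_, ?_, fun b hb hbS => ?_⟩
    · rw [hfg z hz, Finset.prod_insert ha, hgg z]
      ring
    · simp only [Finset.mem_insert, forall_eq_or_imp]
      refine ⟨by rw [h3, h2 a hS.1 ha], fun b hb => ?_⟩
      rw [h4 b (hS.2 b hb) (by rintro rfl; exact ha hb), h1 b hb]
    · rw [Finset.mem_insert, not_or] at hbS
      rw [h4 b hb hbS.1, h2 b hb hbS.2]

/-! ### Finite Blaschke products -/

/-- The sign of the right side yields both facts about Blaschke factors: modulus below `1` in the
disc and equal to `1` on the circle. -/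
theorem norm_one_sub_conj_mul_sq_sub (a z : ℂ) :
    ‖1 - starRingEnd ℂ a * z‖ ^ 2 - ‖z - a‖ ^ 2 = (1 - ‖a‖ ^ 2) * (1 - ‖z‖ ^ 2) := by
  simp only [Complex.sq_norm, Complex.normSq_apply, Complex.sub_re, Complex.sub_im,
    Complex.mul_re, Complex.mul_im, Complex.one_re, Complex.one_im, Complex.conj_re,
    Complex.conj_im]
  ring

theorem one_sub_conj_mul_ne_zero {a z : ℂ} (ha : a ∈ ball (0 : ℂ) 1)
    (hz : z ∈ closedBall (0 : ℂ) 1) : 1 - starRingEnd ℂ a * z ≠ 0 := by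
  rw [mem_ball_zero_iff] at ha
  rw [mem_closedBall_zero_iff] at hz
  intro h
  have h1 : ‖starRingEnd ℂ a * z‖ = 1 := by rw [← sub_eq_zero.1 h, norm_one]
  rw [norm_mul, RCLike.norm_conj] at h1
  nlinarith [norm_nonneg a, norm_nonneg z]

theorem norm_sub_div_one_sub_conj_mul_lt {a z : ℂ} (ha : a ∈ ball (0 : ℂ) 1)
    (hz : z ∈ ball (0 : ℂ) 1) : ‖(z - a) / (1 - starRingEnd ℂ a * z)‖ < 1 := by
  have h0 := one_sub_conj_mul_ne_zero ha (ball_subset_closedBall hz)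
  have h := norm_one_sub_conj_mul_sq_sub a z
  rw [mem_ball_zero_iff] at ha hz
  rw [norm_div, div_lt_one (norm_pos_iff.2 h0)]
  refine lt_of_pow_lt_pow_left₀ 2 (norm_nonneg _) ?_
  have : 0 < (1 - ‖a‖ ^ 2) * (1 - ‖z‖ ^ 2) := by
    apply mul_pos <;> nlinarith [norm_nonneg a, norm_nonneg z]
  linarith

/-- The finite Blaschke product with zeros `a ∈ S` of multiplicities `n a`. -/
noncomputable def finiteBlaschke (S : Finset ℂ) (n : ℂ → ℕ) (z : ℂ) : ℂ :=
  ∏ a ∈ S, ((z - a) / (1 - starRingEnd ℂ a * z)) ^ n a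

theorem norm_finiteBlaschke_zero (S : Finset ℂ) (n : ℂ → ℕ) :
    ‖finiteBlaschke S n 0‖ = ∏ a ∈ S, ‖a‖ ^ n a := by
  simp [finiteBlaschke]

theorem norm_finiteBlaschke_le_one {S : Finset ℂ} (hS : ∀ a ∈ S, a ∈ ball (0 : ℂ) 1) (n : ℂ → ℕ)
    {z : ℂ} (hz : z ∈ ball (0 : ℂ) 1) : ‖finiteBlaschke S n z‖ ≤ 1 := by
  rw [finiteBlaschke, norm_prod]
  refine Finset.prod_le_one (fun _ _ => norm_nonneg _) fun a ha => ?_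
  rw [norm_pow]
  exact pow_le_one₀ (norm_nonneg _) (norm_sub_div_one_sub_conj_mul_lt (hS a ha) hz).le

theorem norm_finiteBlaschke_eq_one {S : Finset ℂ} (hS : ∀ a ∈ S, a ∈ ball (0 : ℂ) 1) (n : ℂ → ℕ)
    {z : ℂ} (hz : ‖z‖ = 1) : ‖finiteBlaschke S n z‖ = 1 := by
  rw [finiteBlaschke, norm_prod]
  refine Finset.prod_eq_one fun a ha => ?_
  have h0 := one_sub_conj_mul_ne_zero (hS a ha) (z := z) (by simp [hz])
  have h := norm_one_sub_conj_mul_sq_sub a z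
  rw [hz, one_pow, sub_self, mul_zero, sub_eq_zero,
    pow_left_inj₀ (norm_nonneg _) (norm_nonneg _) two_ne_zero] at h
  rw [norm_pow, norm_div, ← h, div_self (norm_ne_zero_iff.2 h0), one_pow]

/-- Finite Blaschke products are close to unimodular on circles close to the unit circle. -/
theorem exists_radius_lt_norm_finiteBlaschke {S : Finset ℂ} (hS : ∀ a ∈ S, a ∈ ball (0 : ℂ) 1)
    (n : ℂ → ℕ) {c : ℝ} (hc : c < 1) :
    ∃ r, 0 ≤ r ∧ r < 1 ∧ ∀ z : ℂ, ‖z‖ = r → c < ‖finiteBlaschke S n z‖ := by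
  have hcont : ContinuousOn (fun z => ‖finiteBlaschke S n z‖) (closedBall 0 1) := by
    refine (continuousOn_finsetProd _ fun a ha => ?_).norm
    exact ((by fun_prop : ContinuousOn (fun z : ℂ => z - a) _).div (by fun_prop)
      fun z hz => one_sub_conj_mul_ne_zero (hS a ha) hz).pow _
  -- This compact set misses the unit circle, so it lies in an open disc of some radius `r < 1`.
  have hK : IsCompact (closedBall (0 : ℂ) 1 ∩ (fun z => ‖finiteBlaschke S n z‖) ⁻¹' Iic c) :=
    (isCompact_closedBall _ _).of_isClosed_subset
      (hcont.preimage_isClosed_of_isClosed isClosed_closedBall isClosed_Iic) inter_subset_left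
  have hK1 : closedBall (0 : ℂ) 1 ∩ (fun z => ‖finiteBlaschke S n z‖) ⁻¹' Iic c ⊆ ball 0 1 := by
    rintro z ⟨hz, hzc⟩
    rw [mem_closedBall_zero_iff] at hz
    rw [mem_ball_zero_iff]
    refine lt_of_le_of_ne hz fun h => ?_
    have : ‖finiteBlaschke S n z‖ ≤ c := hzc
    rw [norm_finiteBlaschke_eq_one hS n h] at this
    linarith
  obtain ⟨r, hr, hKr⟩ := exists_pos_lt_subset_ball one_pos hK.isClosed hK1
  refine ⟨r, hr.1.le, hr.2, fun z hz => ?_⟩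
  by_contra! h
  have := hKr ⟨mem_closedBall_zero_iff.2 (hz.trans_le hr.2.le), h⟩
  rw [mem_ball_zero_iff] at this
  linarith

/-! ### Comparison of Blaschke products -/

/-- If `G` is a holomorphic function on the disc which is proper in the sense that the fibre
products with `f` are compact over `‖ζ‖ ≤ r`, then the Blaschke product of the `p`-points of `G`
is at the origin dominated by that of any finitely many `p`-points of `f`. -/
theorem prod_norm_pow_le_of_fibreProduct {G f : ℂ → ℂ} {p : ℂ}
    (hG : DifferentiableOn ℂ G (ball 0 1)) (hf : DifferentiableOn ℂ f (ball 0 1))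
    (hGn : ∀ z ∈ ball (0 : ℂ) 1, analyticOrderAt (fun w => G w - G z) z ≠ ⊤)
    (hY : ∀ r < 1,
      IsCompact {y : ℂ × ℂ | y.1 ∈ closedBall 0 r ∧ y.2 ∈ ball (0 : ℂ) 1 ∧ G y.2 = f y.1})
    (h₀ : G 0 = f 0) {T : Finset ℂ} (hT : ∀ z, z ∈ T ↔ z ∈ ball (0 : ℂ) 1 ∧ G z = p)
    {S : Finset ℂ} (hS : ∀ a ∈ S, a ∈ ball (0 : ℂ) 1) {n : ℂ → ℕ}
    (hn : ∀ a ∈ S, n a ≤ analyticOrderAt (fun z => f z - p) a) :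
    ∏ b ∈ T, ‖b‖ ^ analyticOrderNatAt (fun z => G z - p) b ≤ ∏ a ∈ S, ‖a‖ ^ n a := by
  set m := analyticOrderNatAt (fun z => G z - p) with hm
  have hTb : ∀ b ∈ T, b ∈ ball (0 : ℂ) 1 := fun b hb => ((hT b).1 hb).1
  have hmT : ∀ b ∈ T, (m b : ℕ∞) = analyticOrderAt (fun z => G z - p) b := fun b hb => by
    have h := (hT b).1 hb
    have := hGn b h.1
    rw [h.2] at this
    exact Nat.cast_analyticOrderNatAt this
  obtain ⟨g, hg, hGg, hgT, -⟩ := (hG.sub_const p).exists_eq_prod_mul isOpen_ball m T hTb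
    fun b hb => (hmT b hb).le
  -- `T` carries all zeros of `G - p` with full multiplicity, so `1 / g` is holomorphic. The
  -- cofactor `h` of `f - p` may vanish, since it only enters a numerator.
  have hg0 : ∀ z ∈ ball (0 : ℂ) 1, g z ≠ 0 := by
    intro z hz hgz
    by_cases hzT : z ∈ T
    · have h1 := hgT z hzT
      rw [← hmT z hzT] at h1
      have h2 : analyticOrderAt g z = 0 := by
        have : (m z : ℕ∞) + analyticOrderAt g z = m z + 0 := by rw [h1, add_zero]
        exact (ENat.add_right_injective_of_ne_top (ENat.natCast_ne_top _)) this
      exact ((hg.analyticAt (isOpen_ball.mem_nhds hz)).analyticOrderAt_eq_zero).1 h2 hgz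
    · have h1 := hGg z hz
      rw [hgz, mul_zero, sub_eq_zero] at h1
      exact hzT ((hT z).2 ⟨hz, h1⟩)
  obtain ⟨h, hh, hfh, -⟩ := (hf.sub_const p).exists_eq_prod_mul isOpen_ball n S hS hn
  set D : Finset ℂ → (ℂ → ℕ) → ℂ → ℂ := fun S n z => ∏ a ∈ S, (1 - starRingEnd ℂ a * z) ^ n a
    with hD
  have hDd : ∀ S n, DifferentiableOn ℂ (D S n) (ball 0 1) := fun S n => by
    simp only [hD]
    fun_prop
  have hD0 : ∀ S : Finset ℂ, (∀ a ∈ S, a ∈ ball (0 : ℂ) 1) → ∀ n, ∀ z ∈ ball (0 : ℂ) 1,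
      D S n z ≠ 0 := fun S hS n z hz => Finset.prod_ne_zero_iff.2 fun a ha =>
    pow_ne_zero _ (one_sub_conj_mul_ne_zero (hS a ha) (ball_subset_closedBall hz))
  have hB : ∀ S n z, finiteBlaschke S n z = (∏ a ∈ S, (z - a) ^ n a) / D S n z := fun S n z => by
    simp only [finiteBlaschke, hD, div_pow, Finset.prod_div_distrib]
  set E : ℂ → ℂ := fun z => 1 / (g z * D T m z) with hE
  set e : ℂ → ℂ := fun ζ => h ζ * D S n ζ with he
  have hEd : DifferentiableOn ℂ E (ball 0 1) :=
    (differentiableOn_const 1).div (hg.mul (hDd T m))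
      fun z hz => mul_ne_zero (hg0 z hz) (hD0 T hTb m z hz)
  have hed : DifferentiableOn ℂ e (ball 0 1) := hh.mul (hDd S n)
  have key : ∀ ζ ∈ ball (0 : ℂ) 1, ∀ z ∈ ball (0 : ℂ) 1, G z = f ζ →
      finiteBlaschke T m z = E z * e ζ * finiteBlaschke S n ζ := by
    intro ζ hζ z hz hGf
    have h1 : (∏ b ∈ T, (z - b) ^ m b) * g z = (∏ a ∈ S, (ζ - a) ^ n a) * h ζ := by
      rw [← hGg z hz, ← hfh ζ hζ, hGf]
    have h2 := hg0 z hz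
    have h3 := hD0 T hTb m z hz
    have h4 := hD0 S hS n ζ hζ
    rw [hB, hB]
    simp only [hE, he]
    field_simp
    linear_combination h1
  have h0b : (0 : ℂ) ∈ ball (0 : ℂ) 1 := by simp
  rw [← norm_finiteBlaschke_zero, ← norm_finiteBlaschke_zero]
  have hbound : ∀ c : ℝ, 0 < c → c < 1 →
      ‖finiteBlaschke T m 0‖ * c ≤ ‖finiteBlaschke S n 0‖ := by
    intro c hc0 hc1
    obtain ⟨r, hr0, hr1, hr⟩ := exists_radius_lt_norm_finiteBlaschke hS n hc1
    obtain ⟨ζ, z, hζ, hz, hGf, hle⟩ := exists_norm_eq_le_of_fibreProduct hr1 hG hf hEd hed hGn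
      (hY r hr1) (mem_closedBall_self hr0) h0b h₀
    have hζb : ζ ∈ ball (0 : ℂ) 1 := mem_ball_zero_iff.2 (hζ.trans_lt hr1)
    have h1 := norm_finiteBlaschke_le_one hTb m hz
    rw [key ζ hζb z hz hGf, norm_mul] at h1
    have h2 : ‖E 0 * e 0‖ * c ≤ 1 := by
      refine le_trans ?_ h1
      exact mul_le_mul hle (hr ζ hζ).le hc0.le (norm_nonneg _)
    rw [key 0 h0b 0 h0b h₀, norm_mul]
    nlinarith [norm_nonneg (finiteBlaschke S n 0)]
  -- Letting `c` tend to `1`: the choice `c = t / ‖finiteBlaschke T m 0‖` turns `hbound` into the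
  -- bound for `t`.
  refine le_of_forall_lt_imp_le_of_dense fun t ht => ?_
  by_cases ht0 : t ≤ 0
  · exact ht0.trans (norm_nonneg _)
  push Not at ht0
  have hpos : 0 < ‖finiteBlaschke T m 0‖ := ht0.trans ht
  have := hbound (t / ‖finiteBlaschke T m 0‖) (by positivity) ((div_lt_one hpos).2 ht)
  rwa [mul_div_cancel₀ _ hpos.ne'] at this

/-! ### Automorphisms, fibres and compactness -/

/-- Disc automorphisms act transitively. -/
theorem exists_isDiscAutomorphism_apply_zero {a : ℂ} (ha : a ∈ ball (0 : ℂ) 1) :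
    ∃ ψ, IsDiscAutomorphism ψ ∧ ψ 0 = a := by
  have hdisc : ∀ {b : ℂ}, b ∈ ball (0 : ℂ) 1 →
      (fun z => (z - b) / (1 - starRingEnd ℂ b * z)) ∈ analyticDiscs (ball 0 1) := by
    intro b hb
    refine ⟨DifferentiableOn.div (by fun_prop) (by fun_prop)
      fun z hz => one_sub_conj_mul_ne_zero hb (ball_subset_closedBall hz), fun z hz => ?_⟩
    rw [mem_ball_zero_iff]
    exact norm_sub_div_one_sub_conj_mul_lt hb hz
  have hinv : ∀ {b : ℂ}, b ∈ ball (0 : ℂ) 1 → LeftInvOn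
      (fun z => (z - -b) / (1 - starRingEnd ℂ (-b) * z))
      (fun z => (z - b) / (1 - starRingEnd ℂ b * z)) (ball 0 1) := by
    intro b hb z hz
    have h1 := one_sub_conj_mul_ne_zero hb (ball_subset_closedBall hz)
    have h2 := div_mul_cancel₀ (z - b) h1
    have h3 : 1 - starRingEnd ℂ (-b) * ((z - b) / (1 - starRingEnd ℂ b * z)) ≠ 0 :=
      one_sub_conj_mul_ne_zero (by simpa using hb) (ball_subset_closedBall ((hdisc hb).2 hz))
    simp only
    rw [div_eq_iff h3, map_neg]
    linear_combination h2
  have hna : -a ∈ ball (0 : ℂ) 1 := by simpa using ha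
  refine ⟨fun z => (z - -a) / (1 - starRingEnd ℂ (-a) * z),
    ⟨hdisc hna, fun z => (z - a) / (1 - starRingEnd ℂ a * z), hdisc ha, ?_, hinv ha⟩, by simp⟩
  simpa only [neg_neg] using hinv hna

/-- A holomorphic function on the disc that is not identically `c` takes `c` with finite order. -/
theorem analyticOrderAt_sub_ne_top {f : ℂ → ℂ} (hf : DifferentiableOn ℂ f (ball 0 1)) {c w : ℂ}
    (hw : w ∈ ball (0 : ℂ) 1) (hwc : f w ≠ c) {a : ℂ} (ha : a ∈ ball (0 : ℂ) 1) :
    analyticOrderAt (fun z => f z - c) a ≠ ⊤ := by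
  intro h
  have h1 := (hf.analyticOnNhd isOpen_ball).eqOn_of_preconnected_of_eventuallyEq
    (g := fun _ => c) analyticOnNhd_const (convex_ball (0 : ℂ) 1).isPreconnected ha
    ((analyticOrderAt_eq_top.1 h).mono fun z hz => sub_eq_zero.1 hz)
  exact hwc (h1 hw)

/-- Compact fibres of nonconstant holomorphic functions are finite. -/
theorem finite_fibre_of_isCompact {f : ℂ → ℂ} (hf : DifferentiableOn ℂ f (ball 0 1)) {c w : ℂ}
    (hw : w ∈ ball (0 : ℂ) 1) (hwc : f w ≠ c) (hK : IsCompact (ball 0 1 ∩ f ⁻¹' {c})) :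
    (ball 0 1 ∩ f ⁻¹' {c}).Finite := by
  by_contra hinf
  obtain ⟨z, hz, hacc⟩ :=
    Set.Infinite.exists_accPt_of_subset_isCompact hinf hK Subset.rfl
  have h1 := (hf.analyticOnNhd isOpen_ball).eqOn_of_preconnected_of_frequently_eq
    (g := fun _ => c) analyticOnNhd_const (convex_ball (0 : ℂ) 1).isPreconnected hz.1
    ((accPt_iff_frequently_nhdsNE.1 hacc).mono fun y hy => hy.2)
  exact hwc (h1 hw)

/-- The fibre product of a disc with a proper disc is compact over smaller closed discs. -/
theorem isCompact_fibreProduct {X : Set ℂ} {G f : ℂ → ℂ} (hG : DifferentiableOn ℂ G (ball 0 1))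
    (hGK : ∀ K ⊆ X, IsCompact K → IsCompact (ball 0 1 ∩ G ⁻¹' K)) (hf : f ∈ analyticDiscs X)
    {r : ℝ} (hr : r < 1) :
    IsCompact {y : ℂ × ℂ | y.1 ∈ closedBall 0 r ∧ y.2 ∈ ball (0 : ℂ) 1 ∧ G y.2 = f y.1} := by
  have hrb : closedBall (0 : ℂ) r ⊆ ball 0 1 := closedBall_subset_ball hr
  have hL : IsCompact (f '' closedBall 0 r) :=
    (isCompact_closedBall _ _).image_of_continuousOn (hf.1.continuousOn.mono hrb)
  have hL' := hGK _ (image_subset_iff.2 fun z hz => hf.2 (hrb hz)) hL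
  have hP := (isCompact_closedBall (0 : ℂ) r).prod hL'
  have hcont : ContinuousOn (fun y : ℂ × ℂ => G y.2 - f y.1)
      (closedBall 0 r ×ˢ (ball 0 1 ∩ G ⁻¹' (f '' closedBall 0 r))) :=
    (hG.continuousOn.comp continuousOn_snd fun y hy => hy.2.1).sub
      (hf.1.continuousOn.comp continuousOn_fst fun y hy => hrb hy.1)
  convert hP.of_isClosed_subset
    (hcont.preimage_isClosed_of_isClosed hP.isClosed (isClosed_singleton (x := (0 : ℂ))))
    inter_subset_left using 1
  ext y
  simp only [mem_ofPred_eq, mem_inter_iff, mem_prod, mem_preimage, mem_singleton_iff, sub_eq_zero]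
  constructor
  · rintro ⟨h1, h2, h3⟩
    exact ⟨⟨h1, h2, y.1, h1, h3.symm⟩, h3⟩
  · rintro ⟨⟨h1, h2, -⟩, h3⟩
    exact ⟨h1, h2, h3⟩

/-! ### Lelong sums as logarithms of Blaschke products -/

theorem poleWeight_eq_sum_ite {N : ℕ} (p : Fin N → ℂ) (m : Fin N → ℝ) (z : ℂ) :
    poleWeight p m z = ∑ j, if z = p j then m j else 0 := by
  simp [poleWeight, indicator_apply]

theorem poleWeight_nonneg {N : ℕ} (p : Fin N → ℂ) {m : Fin N → ℝ} (hm : ∀ j, 0 < m j) (z : ℂ) :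
    0 ≤ poleWeight p m z := by
  rw [poleWeight_eq_sum_ite]
  refine Finset.sum_nonneg fun j _ => ?_
  split_ifs
  exacts [(hm j).le, le_rfl]

/-- Positive masses cannot cancel, even when the points `p j` repeat. -/
theorem ne_of_poleWeight_eq_zero {N : ℕ} {p : Fin N → ℂ} {m : Fin N → ℝ} (hm : ∀ j, 0 < m j)
    {z : ℂ} (hz : poleWeight p m z = 0) (j : Fin N) : z ≠ p j := by
  rw [poleWeight_eq_sum_ite, Finset.sum_eq_zero_iff_of_nonneg] at hz
  · intro h
    have := hz j (Finset.mem_univ j)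
    rw [if_pos h] at this
    exact (hm j).ne' this
  · intro j _
    split_ifs
    exacts [(hm j).le, le_rfl]

/-- At a point of finite multiplicity different from the origin, the term of the Lelong functional
is a real number. -/
theorem lelongTerm_eq_coe {α : ℂ → ℝ} {f : ℂ → ℂ} {a : ℂ}
    (h : α (f a) ≠ 0 → multiplicityAt f a ≠ ⊤ ∧ a ≠ 0) :
    lelongTerm α f a =
      ((α (f a) * analyticOrderNatAt (fun z => f z - f a) a * Real.log ‖a‖ : ℝ) : EReal) := by
  by_cases h0 : α (f a) = 0
  · simp [lelongTerm, h0]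
  obtain ⟨h1, h2⟩ := h h0
  have h3 : ENNReal.log ‖a‖ₑ = (Real.log ‖a‖ : ℝ) := by
    rw [← ofReal_norm, ENNReal.log_ofReal_of_pos (norm_pos_iff.2 h2)]
  have h4 : multiplicityAt f a = (analyticOrderNatAt (fun z => f z - f a) a : ℕ∞) :=
    (Nat.cast_analyticOrderNatAt h1).symm
  rw [lelongTerm, h3, h4]
  push_cast
  rfl

open Classical in
/-- The real partial sums of the Lelong functional, grouped by poles. -/
theorem sum_poleWeight_mul_eq {N : ℕ} (p : Fin N → ℂ) (m : Fin N → ℝ) (f : ℂ → ℂ)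
    (h : ∀ j, f 0 ≠ p j) (S : Finset ℂ) :
    ∑ a ∈ S, poleWeight p m (f a) * analyticOrderNatAt (fun z => f z - f a) a * Real.log ‖a‖ =
      ∑ j, m j * Real.log (∏ a ∈ S with f a = p j,
        ‖a‖ ^ analyticOrderNatAt (fun z => f z - p j) a) := by
  simp only [poleWeight_eq_sum_ite, Finset.sum_mul]
  rw [Finset.sum_comm]
  refine Finset.sum_congr rfl fun j _ => ?_
  rw [Real.log_prod, Finset.mul_sum, Finset.sum_filter]
  · refine Finset.sum_congr rfl fun a _ => ?_
    split_ifs with ha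
    · rw [Real.log_pow, ha, mul_assoc]
    · simp
  · intro a ha
    refine pow_ne_zero _ (norm_ne_zero_iff.2 ?_)
    rintro rfl
    exact h j (Finset.mem_filter.1 ha).2

theorem ereal_coe_sum {ι : Type*} (s : Finset ι) (u : ι → ℝ) :
    ((∑ i ∈ s, u i : ℝ) : EReal) = ∑ i ∈ s, (u i : EReal) :=
  map_sum (⟨⟨Real.toEReal, EReal.coe_zero⟩, EReal.coe_add⟩ : ℝ →+ EReal) u s

/-- Outside the poles, a proper disc minimizes the Lelong functional. -/
theorem lelongFunctional_le_of_proper {X : Set ℂ} {G f : ℂ → ℂ} (hG : G ∈ analyticDiscs X)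
    (hGK : ∀ K ⊆ X, IsCompact K → IsCompact (ball 0 1 ∩ G ⁻¹' K)) (hGX : G '' ball 0 1 = X)
    (hf : f ∈ analyticDiscs X) (h₀ : G 0 = f 0) {N : ℕ} {p : Fin N → ℂ} (hp : ∀ j, p j ∈ X)
    {m : Fin N → ℝ} (hm : ∀ j, 0 < m j) (hα : poleWeight p m (G 0) = 0) :
    lelongFunctional (poleWeight p m) G ≤ lelongFunctional (poleWeight p m) f := by
  classical
  have h0b : (0 : ℂ) ∈ ball (0 : ℂ) 1 := by simp
  have hx := ne_of_poleWeight_eq_zero hm hα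
  have hterm : ∀ g ∈ analyticDiscs X, g 0 = G 0 → ∀ a : ball (0 : ℂ) 1,
      lelongTerm (poleWeight p m) g a = ((poleWeight p m (g a) *
        analyticOrderNatAt (fun z => g z - g a) a * Real.log ‖(a : ℂ)‖ : ℝ) : EReal) := by
    intro g hg hg0 a
    refine lelongTerm_eq_coe fun ha => ?_
    have hga : g 0 ≠ g a := fun h => ha (by rw [← h, hg0, hα])
    refine ⟨analyticOrderAt_sub_ne_top hg.1 h0b hga a.2, fun h => hga (by rw [h])⟩
  have hfin : ∀ j, (ball 0 1 ∩ G ⁻¹' {p j}).Finite := fun j =>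
    finite_fibre_of_isCompact hG.1 h0b (hx j)
      (hGK _ (singleton_subset_iff.2 (hp j)) isCompact_singleton)
  set T : Finset ℂ := Finset.univ.biUnion fun j => (hfin j).toFinset with hTdef
  have hT : ∀ b ∈ T, b ∈ ball (0 : ℂ) 1 := by
    intro b hb
    obtain ⟨j, -, hj⟩ := Finset.mem_biUnion.1 hb
    exact ((hfin j).mem_toFinset.1 hj).1
  have hTj : ∀ j b, b ∈ T.filter (fun b => G b = p j) ↔ b ∈ ball (0 : ℂ) 1 ∧ G b = p j := by
    intro j b
    rw [Finset.mem_filter]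
    refine ⟨fun h => ⟨hT b h.1, h.2⟩, fun h => ⟨?_, h.2⟩⟩
    exact Finset.mem_biUnion.2 ⟨j, Finset.mem_univ j, (hfin j).mem_toFinset.2 h⟩
  rw [(hasSum_lelongFunctional (poleWeight_nonneg p hm) G).2,
    (hasSum_lelongFunctional (poleWeight_nonneg p hm) f).2]
  -- Both functionals are infima of finite partial sums, so each partial sum of `f` need only be
  -- bounded below by the single one of `G` over all its pole points.
  refine le_iInf fun S => iInf_le_of_le (T.subtype (· ∈ ball (0 : ℂ) 1)) ?_
  rw [Finset.sum_congr rfl fun a _ => hterm G hG rfl a,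
    Finset.sum_congr rfl fun a _ => hterm f hf h₀.symm a, ← ereal_coe_sum,
    ← ereal_coe_sum, EReal.coe_le_coe_iff,
    Finset.sum_subtype_of_mem (fun a => poleWeight p m (G a) *
        analyticOrderNatAt (fun z => G z - G a) a * Real.log ‖a‖) hT]
  have hS := Finset.sum_map S (Function.Embedding.subtype (· ∈ ball (0 : ℂ) 1))
    fun a => poleWeight p m (f a) * analyticOrderNatAt (fun z => f z - f a) a * Real.log ‖a‖
  simp only [Function.Embedding.subtype_apply] at hS
  rw [← hS, sum_poleWeight_mul_eq p m G hx, sum_poleWeight_mul_eq p m f (h₀ ▸ hx)]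
  refine Finset.sum_le_sum fun j _ => mul_le_mul_of_nonneg_left ?_ (hm j).le
  have hpos : 0 < ∏ a ∈ T with G a = p j, ‖a‖ ^ analyticOrderNatAt (fun z => G z - p j) a := by
    refine Finset.prod_pos fun b hb => pow_pos (norm_pos_iff.2 ?_) _
    rintro rfl
    exact hx j (Finset.mem_filter.1 hb).2
  refine Real.log_le_log hpos ?_
  -- Since `G b = p j ≠ G 0`, the disc `G` is nonconstant, so all its multiplicities are finite.
  obtain ⟨b, hb, hbp⟩ : p j ∈ G '' ball 0 1 := hGX ▸ hp j
  have hSb : ∀ a ∈ (S.map (Function.Embedding.subtype (· ∈ ball (0 : ℂ) 1))).filter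
      (fun a => f a = p j), a ∈ ball (0 : ℂ) 1 := by
    intro a ha
    obtain ⟨a', -, rfl⟩ := Finset.mem_map.1 (Finset.mem_filter.1 ha).1
    exact a'.2
  refine prod_norm_pow_le_of_fibreProduct hG.1 hf.1 (fun z hz => ?_)
    (fun r hr => isCompact_fibreProduct hG.1 hGK hf hr) h₀ (hTj j) hSb fun a ha => ?_
  · by_cases hz0 : G 0 = G z
    · exact analyticOrderAt_sub_ne_top hG.1 hb (by rw [hbp, ← hz0]; exact (hx j).symm) hz
    · exact analyticOrderAt_sub_ne_top hG.1 h0b hz0 hz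
  · exact (Nat.cast_analyticOrderNatAt
      (analyticOrderAt_sub_ne_top hf.1 h0b (h₀ ▸ hx j) (hSb a ha))).le

/-- The Lelong functional is `-∞` at discs centred at a pole. -/
theorem lelongFunctional_eq_bot {f : ℂ → ℂ} (hf : DifferentiableOn ℂ f (ball 0 1)) {α : ℂ → ℝ}
    (hα : ∀ z, 0 ≤ α z) (h : α (f 0) ≠ 0) : lelongFunctional α f = ⊥ := by
  rw [(hasSum_lelongFunctional hα f).2, eq_bot_iff]
  -- The term at the origin alone is `-∞`: its weight and multiplicity are positive and `log 0 =
  -- -∞`.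
  refine iInf_le_of_le {⟨0, by simp⟩} ?_
  rw [Finset.sum_singleton, lelongTerm, enorm_zero, ENNReal.log_zero, EReal.mul_bot_of_pos]
  have h1 : multiplicityAt f 0 ≠ 0 :=
    analyticOrderAt_ne_zero.2 ⟨(hf.sub_const _).analyticAt (ball_mem_nhds _ one_pos), sub_self _⟩
  refine EReal.mul_pos (EReal.coe_pos.2 ((hα _).lt_of_ne' h)) ?_
  rw [EReal.coe_ennreal_pos, pos_iff_ne_zero]
  exact fun h2 => h1 (ENat.toENNReal_inj.1 (h2.trans ENat.toENNReal_zero.symm))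

/-! ### Reparametrization and the minimum -/

/-- Composition with a disc automorphism preserves properness. -/
theorem isCompact_preimage_comp_of_isDiscAutomorphism {X : Set ℂ} {F ψ : ℂ → ℂ}
    (hF : MapsTo F (ball 0 1) X) (hFproper : IsProperMap (hF.restrict F (ball 0 1) X))
    (hψ : IsDiscAutomorphism ψ) {K : Set ℂ} (hKX : K ⊆ X) (hK : IsCompact K) :
    IsCompact (ball 0 1 ∩ (F ∘ ψ) ⁻¹' K) := by
  obtain ⟨hψ, φ, hφ, hφψ, hψφ⟩ := hψ
  have h1 : IsCompact ((↑) ⁻¹' K : Set X) :=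
    Topology.IsInducing.subtypeVal.isCompact_preimage_iff (by simpa using hKX) |>.2 hK
  have h2 := (hFproper.isCompact_preimage h1).image continuous_subtype_val
  have h3 : Subtype.val '' (hF.restrict F (ball 0 1) X ⁻¹' ((↑) ⁻¹' K)) = ball 0 1 ∩ F ⁻¹' K := by
    ext z
    simp [and_comm]
  rw [h3] at h2
  -- The preimage of `K` under `F ∘ ψ` in the disc is the image under `φ`, the inverse of `ψ`, of
  -- the compact preimage under `F`.
  convert h2.image_of_continuousOn (hφ.1.continuousOn.mono inter_subset_left) using 1
  ext z
  constructor
  · rintro ⟨hz, hzK⟩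
    exact ⟨ψ z, ⟨hψ.2 hz, hzK⟩, hφψ hz⟩
  · rintro ⟨w, ⟨hw, hwK⟩, rfl⟩
    refine ⟨hφ.2 hw, ?_⟩
    simpa [hψφ hw] using hwK

theorem theorem7 (X : Set ℂ) (hX : IsOpen X)
    (F : ℂ → ℂ) (hF : F ∈ analyticDiscs X)
    (hFproper : IsProperMap (hF.2.restrict F (ball 0 1) X))
    (hFimage : F '' ball 0 1 = X)
    (N : ℕ) (p : Fin N → ℂ) (hp : ∀ j, p j ∈ X) (m : Fin N → ℝ) (hm : ∀ j, 0 < m j)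
    (x : ℂ) (hx : x ∈ X) :
    (∃ ψ, IsDiscAutomorphism ψ ∧ F (ψ 0) = x) ∧
    ∀ ψ, IsDiscAutomorphism ψ → F (ψ 0) = x →
      F ∘ ψ ∈ analyticDiscs X ∧ (F ∘ ψ) 0 = x ∧
      lelongEnvelope X (poleWeight p m) x = lelongFunctional (poleWeight p m) (F ∘ ψ) := by
  constructor
  · obtain ⟨a, ha, rfl⟩ := hFimage.symm ▸ hx
    obtain ⟨ψ, hψ, hψ0⟩ := exists_isDiscAutomorphism_apply_zero ha
    exact ⟨ψ, hψ, by rw [hψ0]⟩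
  intro ψ hψ hψx
  have hG : F ∘ ψ ∈ analyticDiscs X :=
    ⟨hF.1.comp hψ.1.1 hψ.1.2, hF.2.comp hψ.1.2⟩
  refine ⟨hG, hψx, le_antisymm (sInf_le ⟨_, ⟨hG, hψx⟩, rfl⟩) (le_sInf ?_)⟩
  rintro _ ⟨f, ⟨hf, hfx⟩, rfl⟩
  by_cases hα : poleWeight p m ((F ∘ ψ) 0) = 0
  · refine lelongFunctional_le_of_proper hG
      (fun K => isCompact_preimage_comp_of_isDiscAutomorphism hF.2 hFproper hψ) ?_ hf
      (hψx.trans hfx.symm) hp hm hα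
    obtain ⟨hψd, φ, hφ, -, hψφ⟩ := hψ
    rw [image_comp, ← hFimage]
    congr 1
    exact Subset.antisymm hψd.2.image_subset fun w hw => ⟨φ w, hφ.2 hw, hψφ hw⟩
  · rw [lelongFunctional_eq_bot hG.1 (poleWeight_nonneg p hm) hα]
    exact bot_le
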